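/- Let $M$ be a compact (Hausdorff, smooth) manifold with a pseudo-Kähler structure $(g,J)$: $g$ is a pseudo-Riemannian metric of any signature, and $J$ is a smooth almost-complex structure such that each $J_x$ is a linear isometry of $(T_xM,g_x)$ and $\nabla J=0$ for the Levi-Civita connection $\nabla$ of $g$ (so that $J$ is integrable and $(M,J)$ is a complex manifold). Suppose that $(M,J)$ has the $\partial\bar\partial$ property: every $d$-closed complex-valued $(p,q)$ form on $M$ that is $\partial$-exact or $\bar\partial$-exact equals $\partial\bar\partial\lambda$ for some $(p-1,q-1)$ form $\lambda$, where forms of bidegree $(p-1,q-1)$ with $p=0$ or $q=0$ are zero. Then every Killing vector field $v$ of $g$ (that is, every smooth vector field $v$ with $\pounds_v g=0$) is real holomorphic: $\pounds_v J=0$. -/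

import Mathlib

open scoped Manifold ContDiff Bundle

noncomputable section

namespace PseudoKahler

/-! ### Pseudo-Riemannian metrics, almost complex structures, the Levi-Civita connection

`M` is a smooth real manifold without boundary, modelled on a finite-dimensional real vector
space `E`. -/

section Metric

variable (E : Type*) [NormedAddCommGroup E] [NormedSpace ℝ E]
  (M : Type*) [TopologicalSpace M] [ChartedSpace E M]

/-- A (not necessarily smooth) vector field on `M`. -/
abbrev VField : Type _ := (x : M) → TangentSpace 𝓘(ℝ, E) x

variable {E M}

/-- The vector field `X` is smooth. -/
def VField.IsSmooth [IsManifold 𝓘(ℝ, E) ∞ M] (X : VField E M) : Prop :=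
  ContMDiff 𝓘(ℝ, E) 𝓘(ℝ, E).tangent ∞ (fun x => (⟨x, X x⟩ : TangentBundle 𝓘(ℝ, E) M))

/-- The vector field `X` is differentiable at `x`. -/
def VField.DiffAt [IsManifold 𝓘(ℝ, E) ∞ M] (X : VField E M) (x : M) : Prop :=
  MDifferentiableAt 𝓘(ℝ, E) 𝓘(ℝ, E).tangent
    (fun y => (⟨y, X y⟩ : TangentBundle 𝓘(ℝ, E) M)) x

variable (E M)

/-- A pseudo-Riemannian metric: a smooth field of nondegenerate symmetric bilinear forms on the
tangent spaces, of arbitrary signature. -/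
structure Metric [IsManifold 𝓘(ℝ, E) ∞ M] where
  /-- The scalar product on each tangent space. -/
  val (x : M) : TangentSpace 𝓘(ℝ, E) x →L[ℝ] TangentSpace 𝓘(ℝ, E) x →L[ℝ] ℝ
  symm (x : M) (v w : TangentSpace 𝓘(ℝ, E) x) : val x v w = val x w v
  nondegenerate (x : M) (v : TangentSpace 𝓘(ℝ, E) x) (hv : ∀ w, val x v w = 0) : v = 0
  smooth : ContMDiff 𝓘(ℝ, E) (𝓘(ℝ, E).prod 𝓘(ℝ, E →L[ℝ] E →L[ℝ] ℝ)) ∞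
    (fun x => Bundle.TotalSpace.mk' (E →L[ℝ] E →L[ℝ] ℝ)
      (E := fun x : M => TangentSpace 𝓘(ℝ, E) x →L[ℝ] TangentSpace 𝓘(ℝ, E) x →L[ℝ] ℝ) x (val x))

/-- An almost complex structure: a smooth field of endomorphisms `J` of the tangent spaces with
`J ∘ J = -1`. -/
structure AlmostComplex [IsManifold 𝓘(ℝ, E) ∞ M] where
  /-- The endomorphism of each tangent space. -/
  val (x : M) : TangentSpace 𝓘(ℝ, E) x →L[ℝ] TangentSpace 𝓘(ℝ, E) x
  sq (x : M) (v : TangentSpace 𝓘(ℝ, E) x) : val x (val x v) = -v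
  smooth : ContMDiff 𝓘(ℝ, E) (𝓘(ℝ, E).prod 𝓘(ℝ, E →L[ℝ] E)) ∞
    (fun x => Bundle.TotalSpace.mk' (E →L[ℝ] E)
      (E := fun x : M => TangentSpace 𝓘(ℝ, E) x →L[ℝ] TangentSpace 𝓘(ℝ, E) x) x (val x))

variable {E M}
variable [IsManifold 𝓘(ℝ, E) ∞ M]

/-- The vector field `J X`. -/
def AlmostComplex.apply (J : AlmostComplex E M) (X : VField E M) : VField E M :=
  fun x => J.val x (X x)

/-- The function `g(X, Y)`. -/
def Metric.pair (g : Metric E M) (X Y : VField E M) : M → ℝ :=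
  fun x => g.val x (X x) (Y x)

/-- `D` is the Levi-Civita connection of `g`: it is torsion-free, `D_X Y - D_Y X = [X, Y]`, and
metric, `X g(Y, Z) = g(D_X Y, Z) + g(Y, D_X Z)`. Here `D Y x w` is the covariant derivative of
`Y` at `x` in the direction `w`. These conditions determine `D Y x` for every `Y` differentiable
at `x`. -/
def IsLeviCivita (g : Metric E M)
    (D : CovariantDerivative 𝓘(ℝ, E) E (TangentSpace 𝓘(ℝ, E) : M → Type _)) : Prop :=
  (∀ (X Y : VField E M) (x : M), X.DiffAt x → Y.DiffAt x →
    D Y x (X x) - D X x (Y x) = VectorField.mlieBracket 𝓘(ℝ, E) X Y x) ∧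
  (∀ (Y Z : VField E M) (x : M), Y.DiffAt x → Z.DiffAt x →
    ∀ w : TangentSpace 𝓘(ℝ, E) x,
      mvfderiv 𝓘(ℝ, E) (g.pair Y Z) x w = g.val x (D Y x w) (Z x) + g.val x (Y x) (D Z x w))

/-- `J` is parallel for the connection `D`: `D_w (J Y) = J (D_w Y)`. -/
def IsParallel (D : CovariantDerivative 𝓘(ℝ, E) E (TangentSpace 𝓘(ℝ, E) : M → Type _))
    (J : AlmostComplex E M) : Prop :=
  ∀ (Y : VField E M) (x : M), Y.DiffAt x → ∀ w : TangentSpace 𝓘(ℝ, E) x,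
    D (J.apply Y) x w = J.val x (D Y x w)

/-- `(M, g, J)` is a pseudo-Kähler manifold: each `J_x` is a linear isometry of `g_x`, and `J` is
parallel for the Levi-Civita connection of `g`. (Then `J` is integrable, so that `(M, J)` is a
complex manifold.) -/
def IsPseudoKahler (g : Metric E M) (J : AlmostComplex E M) : Prop :=
  (∀ (x : M) (v w : TangentSpace 𝓘(ℝ, E) x),
    g.val x (J.val x v) (J.val x w) = g.val x v w) ∧
  ∃ D : CovariantDerivative 𝓘(ℝ, E) E (TangentSpace 𝓘(ℝ, E) : M → Type _),
    IsLeviCivita g D ∧ IsParallel D J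

/-- The smooth vector field `v` is Killing: the Lie derivative of `g` along `v`, that is,
`(X, Y) ↦ v g(X, Y) - g([v, X], Y) - g(X, [v, Y])`, is zero. -/
def IsKilling (g : Metric E M) (v : VField E M) : Prop :=
  v.IsSmooth ∧
  ∀ (X Y : VField E M) (x : M), X.DiffAt x → Y.DiffAt x →
    mvfderiv 𝓘(ℝ, E) (g.pair X Y) x (v x)
      - g.val x (VectorField.mlieBracket 𝓘(ℝ, E) v X x) (Y x)
      - g.val x (X x) (VectorField.mlieBracket 𝓘(ℝ, E) v Y x) = 0

/-- The Lie derivative of `J` along `v`, evaluated on a vector field: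
`(£_v J) X = [v, J X] - J [v, X]`. -/
def lieDerivJ (J : AlmostComplex E M) (v X : VField E M) : VField E M :=
  fun x => VectorField.mlieBracket 𝓘(ℝ, E) v (J.apply X) x
    - J.val x (VectorField.mlieBracket 𝓘(ℝ, E) v X x)

/-- The vector field `v` is real holomorphic: `£_v J = 0`. -/
def IsRealHolomorphic (J : AlmostComplex E M) (v : VField E M) : Prop :=
  ∀ (X : VField E M) (x : M), X.DiffAt x → lieDerivJ J v X x = 0

end Metric

/-! ### Complex-valued differential forms and the `∂∂̄` property -/

section Forms

variable (E : Type*) [NormedAddCommGroup E] [NormedSpace ℝ E]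
  (M : Type*) [TopologicalSpace M] [ChartedSpace E M]

/-- A (not necessarily smooth) complex-valued differential form of degree `k` on `M`. -/
abbrev DForm (k : ℕ) : Type _ := (x : M) → (TangentSpace 𝓘(ℝ, E) x) [⋀^Fin k]→L[ℝ] ℂ

variable {E M} {k : ℕ}

/-- The expression of `η` in the chart around `x₀`: its pullback to `E` under the inverse of the
chart (meaningful on the target of the chart). -/
def DForm.inChart (η : DForm E M k) (x₀ : M) : E → E [⋀^Fin k]→L[ℝ] ℂ := fun y =>
  (η ((extChartAt 𝓘(ℝ, E) x₀).symm y)).compContinuousLinearMap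
    (mfderiv 𝓘(ℝ, E) 𝓘(ℝ, E) (extChartAt 𝓘(ℝ, E) x₀).symm y :
      E →L[ℝ] TangentSpace 𝓘(ℝ, E) ((extChartAt 𝓘(ℝ, E) x₀).symm y))

/-- The form `η` is smooth: so are its expressions in charts. -/
def DForm.IsSmooth (η : DForm E M k) : Prop :=
  ∀ x₀ : M, ContDiffOn ℝ ∞ (η.inChart x₀) (extChartAt 𝓘(ℝ, E) x₀).target

/-- The exterior derivative, computed at `x` in the chart around `x`. -/
def DForm.d (η : DForm E M k) : DForm E M (k + 1) := fun x =>
  (extDeriv (η.inChart x) (extChartAt 𝓘(ℝ, E) x x)).compContinuousLinearMap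
    (mfderiv 𝓘(ℝ, E) 𝓘(ℝ, E) (extChartAt 𝓘(ℝ, E) x) x : TangentSpace 𝓘(ℝ, E) x →L[ℝ] E)

variable [IsManifold 𝓘(ℝ, E) ∞ M]

/-- `η ∈ Ω^{p,q} M`: the form `η` is smooth, and multiplication by nonzero complex numbers
`z = a + b i` (acting on tangent vectors as `a + b J`) satisfies
`η(z v₁, …, z v_k) = z ^ p * z̄ ^ q * η(v₁, …, v_k)`.
The bidegree may be any pair of integers: for `η ≠ 0` the condition forces `p, q ≥ 0` and
`p + q = k`, and so a form of any other bidegree is zero. -/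
def HasBidegree (J : AlmostComplex E M) (p q : ℤ) (η : DForm E M k) : Prop :=
  η.IsSmooth ∧
  ∀ (x : M) (z : ℂ), z ≠ 0 → ∀ v : Fin k → TangentSpace 𝓘(ℝ, E) x,
    η x (fun j => z.re • v j + z.im • J.val x (v j))
      = z ^ p * (starRingEnd ℂ z) ^ q * η x v

/-- For `β ∈ Ω^{p,q} M`, on a complex manifold: `α = ∂β`, i.e. `α` is the `(p+1,q)` component in
the decomposition `dβ = ∂β + ∂̄β` with `∂β ∈ Ω^{p+1,q} M` and `∂̄β ∈ Ω^{p,q+1} M`. -/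
def IsDel (J : AlmostComplex E M) (p q : ℤ) (β : DForm E M k) (α : DForm E M (k + 1)) : Prop :=
  HasBidegree J p q β ∧ HasBidegree J (p + 1) q α ∧ HasBidegree J p (q + 1) (β.d - α)

/-- For `β ∈ Ω^{p,q} M`, on a complex manifold: `α = ∂̄β`, the `(p,q+1)` component of `dβ`. -/
def IsDelbar (J : AlmostComplex E M) (p q : ℤ) (β : DForm E M k) (α : DForm E M (k + 1)) : Prop :=
  HasBidegree J p q β ∧ HasBidegree J p (q + 1) α ∧ HasBidegree J (p + 1) q (β.d - α)

/-- The `∂∂̄` property of the complex manifold `(M, J)`: every closed `(p,q)` form `α` that is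
`∂`-exact or `∂̄`-exact equals `∂∂̄λ` for some `(p-1,q-1)` form `λ`. (A `(p-1,q-1)` form is zero
if `p = 0` or `q = 0`. In degrees `p + q ≤ 1`, which are left out, the corresponding assertion,
`α = 0`, is true on every compact complex manifold.) -/
def HasDdbarProperty (J : AlmostComplex E M) : Prop :=
  ∀ (k : ℕ) (p q : ℤ) (α : DForm E M (k + 2)), HasBidegree J p q α → α.d = 0 →
    ((∃ β : DForm E M (k + 1), IsDel J (p - 1) q β α) ∨
      (∃ β : DForm E M (k + 1), IsDelbar J p (q - 1) β α)) →
    ∃ (lam : DForm E M k) (μ : DForm E M (k + 1)),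
      IsDelbar J (p - 1) (q - 1) lam μ ∧ IsDel J (p - 1) q μ α

end Forms

end PseudoKahler

end

noncomputable section

namespace PseudoKahler

/-! ### Vector fields and Lie brackets in charts. -/

section Charts

variable {E : Type*} [NormedAddCommGroup E] [NormedSpace ℝ E]
  {M : Type*} [TopologicalSpace M] [ChartedSpace E M]

/-! Write A = ∇v. The Killing equation makes A skew-adjoint (`IsKilling.skew`). Let θ = g(Jv, ·) and
τ = dθ. As J is parallel and g-skew, τ(a, b) = g((JA - AJ)a, b) (from `IsLeviCivita.d_flat`). The
commutator JA - AJ anticommutes with J, so τ has no (1,1) part: it is an exact form of type (2,0) +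
(0,2).

Let α be the (2,0) part of τ and β the (1,0) part of θ. Then α = ∂β. It is also closed: since J is
parallel, τ(J·, ·) is closed along with τ (`d_contract_eq_zero`). The ∂∂̄ property writes α as ∂∂̄λ
with λ of bidegree (1,-1), that is λ = 0, whence α = 0 (`HasDdbarProperty.eq_zero`). As τ is real,
it is twice the real part of α and so vanishes, and nondegeneracy of g gives JA = AJ
(`IsKilling.commute`). For a torsion-free connection with J parallel, £_v J is exactly this
commutator.

Exterior derivatives are computed on fields parallel at a given point (`exists_parallel_extension`):
their brackets vanish there, so `DForm.d_apply` involves only derivatives of functions. -/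

/-- The expression of the vector field `X` in the chart around `x₀`. -/
def VField.inChart (X : VField E M) (x₀ : M) : E → E := fun y =>
  (mfderiv 𝓘(ℝ, E) 𝓘(ℝ, E) (extChartAt 𝓘(ℝ, E) x₀) ((extChartAt 𝓘(ℝ, E) x₀).symm y) :
    TangentSpace 𝓘(ℝ, E) ((extChartAt 𝓘(ℝ, E) x₀).symm y) →L[ℝ] E)
    (X ((extChartAt 𝓘(ℝ, E) x₀).symm y))

theorem VField.inChart_extChartAt (X : VField E M) {x₀ z : M}
    (hz : z ∈ (extChartAt 𝓘(ℝ, E) x₀).source) :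
    X.inChart x₀ (extChartAt 𝓘(ℝ, E) x₀ z)
      = mfderiv 𝓘(ℝ, E) 𝓘(ℝ, E) (extChartAt 𝓘(ℝ, E) x₀) z (X z) :=
  congrArg (fun z => (mfderiv 𝓘(ℝ, E) 𝓘(ℝ, E) (extChartAt 𝓘(ℝ, E) x₀) z :
    TangentSpace 𝓘(ℝ, E) z →L[ℝ] E) (X z)) ((extChartAt 𝓘(ℝ, E) x₀).left_inv hz)

variable [IsManifold 𝓘(ℝ, E) ∞ M]

theorem mfderiv_extChartAt_symm_comp {x₀ : M} {y : E}
    (hy : y ∈ (extChartAt 𝓘(ℝ, E) x₀).target) :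
    (mfderiv 𝓘(ℝ, E) 𝓘(ℝ, E) (extChartAt 𝓘(ℝ, E) x₀).symm y) ∘L
      (mfderiv 𝓘(ℝ, E) 𝓘(ℝ, E) (extChartAt 𝓘(ℝ, E) x₀) ((extChartAt 𝓘(ℝ, E) x₀).symm y))
      = ContinuousLinearMap.id _ _ := by
  have : IsManifold 𝓘(ℝ, E) 1 M := .of_le (n := ∞) (by simp)
  have h := mfderivWithin_extChartAt_symm_comp_mfderiv_extChartAt (I := 𝓘(ℝ, E)) hy
  simpa only [ModelWithCorners.range_eq_univ, mfderivWithin_univ] using h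

theorem mfderiv_extChartAt_comp_symm {x₀ : M} {y : E}
    (hy : y ∈ (extChartAt 𝓘(ℝ, E) x₀).target) :
    (mfderiv 𝓘(ℝ, E) 𝓘(ℝ, E) (extChartAt 𝓘(ℝ, E) x₀) ((extChartAt 𝓘(ℝ, E) x₀).symm y)) ∘L
      (mfderiv 𝓘(ℝ, E) 𝓘(ℝ, E) (extChartAt 𝓘(ℝ, E) x₀).symm y)
      = ContinuousLinearMap.id _ _ := by
  have : IsManifold 𝓘(ℝ, E) 1 M := .of_le (n := ∞) (by simp)
  have h := mfderiv_extChartAt_comp_mfderivWithin_extChartAt_symm (I := 𝓘(ℝ, E)) hy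
  simpa only [ModelWithCorners.range_eq_univ, mfderivWithin_univ] using h

theorem mdifferentiableAt_extChartAt_symm {x₀ : M} {y : E}
    (hy : y ∈ (extChartAt 𝓘(ℝ, E) x₀).target) :
    MDifferentiableAt 𝓘(ℝ, E) 𝓘(ℝ, E) (extChartAt 𝓘(ℝ, E) x₀).symm y := by
  have : IsManifold 𝓘(ℝ, E) 1 M := .of_le (n := ∞) (by simp)
  have h := mdifferentiableWithinAt_extChartAt_symm (I := 𝓘(ℝ, E)) hy
  simpa only [ModelWithCorners.range_eq_univ, mdifferentiableWithinAt_univ] using h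

theorem mfderiv_symm_inChart (X : VField E M) {x₀ : M} {y : E}
    (hy : y ∈ (extChartAt 𝓘(ℝ, E) x₀).target) :
    mfderiv 𝓘(ℝ, E) 𝓘(ℝ, E) (extChartAt 𝓘(ℝ, E) x₀).symm y (X.inChart x₀ y)
      = X ((extChartAt 𝓘(ℝ, E) x₀).symm y) :=
  congr($(mfderiv_extChartAt_symm_comp hy) (X ((extChartAt 𝓘(ℝ, E) x₀).symm y)))

theorem DForm.inChart_apply_inChart {k : ℕ} (η : DForm E M k) (X : Fin k → VField E M) {x₀ : M}
    {y : E} (hy : y ∈ (extChartAt 𝓘(ℝ, E) x₀).target) :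
    η.inChart x₀ y (fun i => (X i).inChart x₀ y)
      = η ((extChartAt 𝓘(ℝ, E) x₀).symm y) (fun i => X i ((extChartAt 𝓘(ℝ, E) x₀).symm y)) := by
  change η _ (fun i => mfderiv 𝓘(ℝ, E) 𝓘(ℝ, E) (extChartAt 𝓘(ℝ, E) x₀).symm y
    ((X i).inChart x₀ y)) = _
  simp only [mfderiv_symm_inChart _ hy]

/-- Bridge between smoothness of sections, which is tested in trivializations of the tangent bundle,
and smoothness of `VField.inChart`. -/
theorem trivializationAt_snd {x₀ z : M} (hz : z ∈ (extChartAt 𝓘(ℝ, E) x₀).source)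
    (w : TangentSpace 𝓘(ℝ, E) z) :
    (trivializationAt E (TangentSpace 𝓘(ℝ, E) : M → Type _) x₀ ⟨z, w⟩).2
      = mfderiv 𝓘(ℝ, E) 𝓘(ℝ, E) (extChartAt 𝓘(ℝ, E) x₀) z w := by
  have : IsManifold 𝓘(ℝ, E) 1 M := .of_le (n := ∞) (by simp)
  have hz' : z ∈ (chartAt E x₀).source := by simpa using hz
  have hb : z ∈ (trivializationAt E (TangentSpace 𝓘(ℝ, E) : M → Type _) x₀).baseSet := by
    simpa using hz'
  have h := TangentBundle.continuousLinearMapAt_trivializationAt (I := 𝓘(ℝ, E)) hz'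
  refine Eq.trans ?_ congr($h w)
  simp [Bundle.Trivialization.linearMapAt_apply, hz']

theorem trivializationAt_baseSet (x₀ : M) :
    (trivializationAt E (TangentSpace 𝓘(ℝ, E) : M → Type _) x₀).baseSet
      = (extChartAt 𝓘(ℝ, E) x₀).source := by
  simp

theorem VField.contDiffOn_inChart {X : VField E M} {x₀ : M}
    (hX : ContMDiffOn 𝓘(ℝ, E) 𝓘(ℝ, E).tangent ∞
      (fun x => (⟨x, X x⟩ : TangentBundle 𝓘(ℝ, E) M)) (extChartAt 𝓘(ℝ, E) x₀).source) :
    ContDiffOn ℝ ∞ (X.inChart x₀) (extChartAt 𝓘(ℝ, E) x₀).target := by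
  rw [← contMDiffOn_iff_contDiffOn]
  rw [← trivializationAt_baseSet] at hX
  have h1 := ((trivializationAt E (TangentSpace 𝓘(ℝ, E) : M → Type _)
    x₀).contMDiffOn_section_baseSet_iff (IB := 𝓘(ℝ, E)) (n := ∞) (s := X)).1 hX
  rw [trivializationAt_baseSet] at h1
  exact (h1.comp (contMDiffOn_extChartAt_symm (I := 𝓘(ℝ, E)) (n := ∞) x₀)
    fun _ hy => (extChartAt 𝓘(ℝ, E) x₀).map_target hy).congr fun y hy =>
      (trivializationAt_snd ((extChartAt 𝓘(ℝ, E) x₀).map_target hy) _).symm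

theorem VField.DiffAt.differentiableAt_inChart {X : VField E M} {x : M} (hX : X.DiffAt x) :
    DifferentiableAt ℝ (X.inChart x) (extChartAt 𝓘(ℝ, E) x x) := by
  have h1 := (mdifferentiableAt_section 𝓘(ℝ, E) X).1 hX
  rw [← mdifferentiableAt_iff_differentiableAt]
  have hx := mem_extChartAt_target (I := 𝓘(ℝ, E)) x
  have h2 : MDifferentiableAt 𝓘(ℝ, E) 𝓘(ℝ, E) (fun z =>
      (trivializationAt E (TangentSpace 𝓘(ℝ, E) : M → Type _) x ⟨z, X z⟩).2)
      ((extChartAt 𝓘(ℝ, E) x).symm (extChartAt 𝓘(ℝ, E) x x)) := by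
    rwa [extChartAt_to_inv]
  refine (h2.comp _ (mdifferentiableAt_extChartAt_symm hx)).congr_of_eventuallyEq ?_
  filter_upwards [extChartAt_target_mem_nhds (I := 𝓘(ℝ, E)) x] with y hy
  exact (trivializationAt_snd ((extChartAt 𝓘(ℝ, E) x).map_target hy) _).symm

theorem mpullbackWithin_symm_eventuallyEq (X : VField E M) (x : M) :
    VectorField.mpullbackWithin 𝓘(ℝ, E) 𝓘(ℝ, E) (extChartAt 𝓘(ℝ, E) x).symm X Set.univ
      =ᶠ[nhds (extChartAt 𝓘(ℝ, E) x x)] X.inChart x := by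
  filter_upwards [extChartAt_target_mem_nhds (I := 𝓘(ℝ, E)) x] with y hy
  rw [VectorField.mpullbackWithin_apply, mfderivWithin_univ]
  exact congr($(ContinuousLinearMap.inverse_eq (mfderiv_extChartAt_symm_comp hy)
    (mfderiv_extChartAt_comp_symm hy)) _)

/-- The manifold bracket is the chart bracket transported by the differential of the chart, which is
invertible; so vanishing passes from one to the other. -/
theorem lieBracket_inChart {X Y : VField E M} {x : M}
    (h : VectorField.mlieBracket 𝓘(ℝ, E) X Y x = 0) :
    VectorField.lieBracket ℝ (X.inChart x) (Y.inChart x) (extChartAt 𝓘(ℝ, E) x x) = 0 := by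
  have : IsManifold 𝓘(ℝ, E) 1 M := .of_le (n := ∞) (by simp)
  rw [← VectorField.mlieBracketWithin_univ, VectorField.mlieBracketWithin_apply] at h
  simp only [ModelWithCorners.range_eq_univ, Set.preimage_univ, Set.inter_univ] at h
  obtain ⟨e, he⟩ := isInvertible_mfderiv_extChartAt (I := 𝓘(ℝ, E)) (mem_extChartAt_source (I := 𝓘(ℝ, E)) x)
  rw [← he, ContinuousLinearMap.inverse_equiv] at h
  have h' := e.symm.map_eq_zero_iff.1 h
  exact ((mpullbackWithin_symm_eventuallyEq X x).lieBracket_vectorField_eq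
    (mpullbackWithin_symm_eventuallyEq Y x)).symm.trans
      ((congrFun VectorField.lieBracketWithin_univ.symm _).trans h')

/-- The derivative of a function along a vector field, computed in the chart. -/
theorem fderiv_comp_symm_inChart {F : Type*} [NormedAddCommGroup F] [NormedSpace ℝ F]
    {f : M → F} {x : M} (X : VField E M)
    (hf : DifferentiableAt ℝ (f ∘ (extChartAt 𝓘(ℝ, E) x).symm) (extChartAt 𝓘(ℝ, E) x x)) :
    fderiv ℝ (f ∘ (extChartAt 𝓘(ℝ, E) x).symm) (extChartAt 𝓘(ℝ, E) x x)
      (X.inChart x (extChartAt 𝓘(ℝ, E) x x)) = mvfderiv 𝓘(ℝ, E) f x (X x) := by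
  have : IsManifold 𝓘(ℝ, E) 1 M := .of_le (n := ∞) (by simp)
  have heq : f =ᶠ[nhds x] (f ∘ (extChartAt 𝓘(ℝ, E) x).symm) ∘ extChartAt 𝓘(ℝ, E) x := by
    filter_upwards [extChartAt_source_mem_nhds (I := 𝓘(ℝ, E)) x] with z hz
    exact congrArg f ((extChartAt 𝓘(ℝ, E) x).left_inv hz).symm
  rw [VField.inChart_extChartAt X (mem_extChartAt_source x)]
  have h := mfderiv_comp_apply x (mdifferentiableAt_iff_differentiableAt.2 hf)
    (mdifferentiableAt_extChartAt (mem_chart_source E x)) (X x)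
  rw [← heq.mfderiv_eq, mfderiv_eq_fderiv] at h
  exact h.symm

end Charts

/-! ### The exterior derivative on a normed space. -/

section ExtDeriv

variable {E F : Type*} [NormedAddCommGroup E] [NormedSpace ℝ E] [NormedAddCommGroup F]
  [NormedSpace ℝ F] {k : ℕ}

set_option synthInstance.maxHeartbeats 200000 in
theorem contDiffAt_extDeriv {θ : E → E [⋀^Fin k]→L[ℝ] F} {y : E} (h : ContDiffAt ℝ ∞ θ y) :
    ContDiffAt ℝ ∞ (extDeriv θ) y := by
  have h1 : ContDiffAt ℝ ∞ (fderiv ℝ θ) y := h.fderiv_right (by simp)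
  let L : (E →L[ℝ] E [⋀^Fin k]→L[ℝ] F) →L[ℝ] E [⋀^Fin (k + 1)]→L[ℝ] F :=
    ContinuousAlternatingMap.alternatizeUncurryFinCLM ℝ E F
  exact h1.continuousLinearMap_comp L

theorem extDeriv_sub {θ₁ θ₂ : E → E [⋀^Fin k]→L[ℝ] F} {y : E} (h₁ : DifferentiableAt ℝ θ₁ y)
    (h₂ : DifferentiableAt ℝ θ₂ y) :
    extDeriv (θ₁ - θ₂) y = extDeriv θ₁ y - extDeriv θ₂ y := by
  simp only [extDeriv, fderiv_sub h₁ h₂]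
  exact (ContinuousAlternatingMap.alternatizeUncurryFinCLM ℝ E F).map_sub _ _

theorem extDeriv_complex_smul [NormedSpace ℂ F] [SMulCommClass ℝ ℂ F] (c : ℂ)
    (θ : E → E [⋀^Fin k]→L[ℝ] F) (y : E) :
    extDeriv (c • θ) y = c • extDeriv θ y := by
  have h : fderiv ℝ (c • θ) y = c • fderiv ℝ θ y :=
    congrFun (fderiv_const_smul_field (𝕜 := ℝ) (f := θ) c) y
  unfold extDeriv
  rw [h]
  exact ContinuousAlternatingMap.alternatizeUncurryFin_smul c _

end ExtDeriv

/-! ### The exterior derivative on the manifold: values on commuting fields, chart independence, d²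
= 0. -/

section Cartan

variable {E : Type*} [NormedAddCommGroup E] [NormedSpace ℝ E]
  {M : Type*} [TopologicalSpace M] [ChartedSpace E M] {k : ℕ}

theorem DForm.IsSmooth.contDiffAt {η : DForm E M k} (hη : η.IsSmooth) {x₀ : M} {y : E}
    (hy : y ∈ (extChartAt 𝓘(ℝ, E) x₀).target) : ContDiffAt ℝ ∞ (η.inChart x₀) y :=
  (hη x₀).contDiffAt ((isOpen_extChartAt_target x₀).mem_nhds hy)

theorem DForm.IsSmooth.differentiableAt {η : DForm E M k} (hη : η.IsSmooth) (x : M) :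
    DifferentiableAt ℝ (η.inChart x) (extChartAt 𝓘(ℝ, E) x x) :=
  (hη.contDiffAt (mem_extChartAt_target x)).differentiableAt (by simp)

theorem DForm.inChart_sub (η ζ : DForm E M k) (x₀ : M) :
    (η - ζ).inChart x₀ = η.inChart x₀ - ζ.inChart x₀ := rfl

theorem DForm.inChart_smul (c : ℂ) (η : DForm E M k) (x₀ : M) :
    (c • η).inChart x₀ = c • η.inChart x₀ := rfl

theorem DForm.IsSmooth.sub {η ζ : DForm E M k} (hη : η.IsSmooth) (hζ : ζ.IsSmooth) :
    (η - ζ).IsSmooth := fun x₀ => (hη x₀).sub (hζ x₀)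

theorem DForm.IsSmooth.smul {η : DForm E M k} (c : ℂ) (hη : η.IsSmooth) :
    (c • η).IsSmooth := fun x₀ => (hη x₀).const_smul c

theorem DForm.d_sub {η ζ : DForm E M k} (hη : η.IsSmooth) (hζ : ζ.IsSmooth) :
    (η - ζ).d = η.d - ζ.d := by
  funext x
  rw [DForm.d, DForm.inChart_sub, extDeriv_sub (hη.differentiableAt x) (hζ.differentiableAt x)]
  rfl

theorem DForm.d_smul {η : DForm E M k} (c : ℂ) : (c • η).d = c • η.d := by
  funext x
  rw [DForm.d, DForm.inChart_smul, extDeriv_complex_smul]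
  rfl

theorem DForm.d_zero : (0 : DForm E M k).d = 0 := by
  funext x
  have h : (0 : DForm E M k).inChart x = 0 := rfl
  have h' : extDeriv (0 : E → E [⋀^Fin k]→L[ℝ] ℂ) (extChartAt 𝓘(ℝ, E) x x) = 0 := by
    simpa using extDeriv_complex_smul 0 (0 : E → E [⋀^Fin k]→L[ℝ] ℂ) (extChartAt 𝓘(ℝ, E) x x)
  rw [DForm.d, h, h']
  rfl

variable [IsManifold 𝓘(ℝ, E) ∞ M]

theorem DForm.inChart_extChartAt (η : DForm E M k) {x₀ z : M}
    (hz : z ∈ (extChartAt 𝓘(ℝ, E) x₀).source) (v : Fin k → TangentSpace 𝓘(ℝ, E) z) :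
    η.inChart x₀ (extChartAt 𝓘(ℝ, E) x₀ z)
      (fun i => mfderiv 𝓘(ℝ, E) 𝓘(ℝ, E) (extChartAt 𝓘(ℝ, E) x₀) z (v i)) = η z v := by
  classical
  set X : Fin k → VField E M := fun i => FiberBundle.extend E (v i) with hX
  have h1 := η.inChart_apply_inChart X ((extChartAt 𝓘(ℝ, E) x₀).map_source hz)
  have h2 : η z (fun i => X i z) = η z v := by simp [hX]
  rw [← h2, ← congrArg (fun z => η z (fun i => X i z)) ((extChartAt 𝓘(ℝ, E) x₀).left_inv hz), ← h1]
  congr 1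
  funext i
  rw [VField.inChart_extChartAt _ hz]
  simp [hX]

/-- The exterior derivative evaluated on vector fields that commute at a point. -/
theorem DForm.d_apply {η : DForm E M k} {x : M} (hη : η.IsSmooth) {X : Fin (k + 1) → VField E M}
    (hX : ∀ i, (X i).DiffAt x)
    (hc : Pairwise fun i j => VectorField.mlieBracket 𝓘(ℝ, E) (X i) (X j) x = 0) :
    η.d x (fun i => X i x) = ∑ i, (-1 : ℤ) ^ i.val •
      mvfderiv 𝓘(ℝ, E) (fun z => η z (i.removeNth fun j => X j z)) x (X i x) := by
  have h1 : η.d x (fun i => X i x) = extDeriv (η.inChart x) (extChartAt 𝓘(ℝ, E) x x)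
      (fun i => (X i).inChart x (extChartAt 𝓘(ℝ, E) x x)) := by
    simp only [VField.inChart_extChartAt _ (mem_extChartAt_source (I := 𝓘(ℝ, E)) x)]
    rfl
  have hV : ∀ i, DifferentiableAt ℝ ((X i).inChart x) (extChartAt 𝓘(ℝ, E) x x) :=
    fun i => (hX i).differentiableAt_inChart
  rw [h1, extDeriv_apply_vectorField_of_pairwise_commute (hη.differentiableAt x) hV
    (fun i j hij => lieBracket_inChart (hc hij))]
  refine Finset.sum_congr rfl fun i _ => ?_
  have heq : (fun y => η.inChart x y (i.removeNth fun j => (X j).inChart x y))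
      =ᶠ[nhds (extChartAt 𝓘(ℝ, E) x x)]
      (fun z => η z (i.removeNth fun j => X j z)) ∘ (extChartAt 𝓘(ℝ, E) x).symm := by
    filter_upwards [extChartAt_target_mem_nhds (I := 𝓘(ℝ, E)) x] with y hy
    exact η.inChart_apply_inChart (i.removeNth X) hy
  have hd : DifferentiableAt ℝ (fun y => η.inChart x y (i.removeNth fun j => (X j).inChart x y))
      (extChartAt 𝓘(ℝ, E) x x) :=
    (hη.differentiableAt x).continuousAlternatingMap_apply (fun j => hV (i.succAbove j))
  rw [heq.fderiv_eq, fderiv_comp_symm_inChart _ (heq.differentiableAt_iff.1 hd)]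

/-- `DForm.d` uses a different chart at each point. Near `y` the expression of `η` around `x₀` is
the pullback, under the transition map `ψ`, of its expression in the chart around the point `z` over
`y`; naturality of `extDeriv` under pullback then makes the choice of chart irrelevant. Smoothness
of `η.d` and d² = 0 rest on this. -/
theorem DForm.inChart_d {η : DForm E M k} (hη : η.IsSmooth) {x₀ : M} {y : E}
    (hy : y ∈ (extChartAt 𝓘(ℝ, E) x₀).target) :
    η.d.inChart x₀ y = extDeriv (η.inChart x₀) y := by
  have : IsManifold 𝓘(ℝ, E) 1 M := .of_le (n := ∞) (by simp)
  set z := (extChartAt 𝓘(ℝ, E) x₀).symm y with hz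
  set ψ : E → E := extChartAt 𝓘(ℝ, E) z ∘ (extChartAt 𝓘(ℝ, E) x₀).symm with hψ
  have hfd : ∀ {y'}, y' ∈ (extChartAt 𝓘(ℝ, E) x₀).target →
      (extChartAt 𝓘(ℝ, E) x₀).symm y' ∈ (extChartAt 𝓘(ℝ, E) z).source → ∀ u : E,
      fderiv ℝ ψ y' u = mfderiv 𝓘(ℝ, E) 𝓘(ℝ, E) (extChartAt 𝓘(ℝ, E) z)
        ((extChartAt 𝓘(ℝ, E) x₀).symm y')
          (mfderiv 𝓘(ℝ, E) 𝓘(ℝ, E) (extChartAt 𝓘(ℝ, E) x₀).symm y' u) := by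
    intro y' hy' hy'' u
    have h := mfderiv_comp_apply y' (mdifferentiableAt_extChartAt (I := 𝓘(ℝ, E)) (x := z)
      (by simpa using hy'')) (mdifferentiableAt_extChartAt_symm hy') u
    rw [mfderiv_eq_fderiv] at h
    exact h
  have hcont : ∀ᶠ y' in nhds y, (extChartAt 𝓘(ℝ, E) x₀).symm y' ∈ (extChartAt 𝓘(ℝ, E) z).source :=
    (continuousAt_extChartAt_symm'' hy).preimage_mem_nhds (extChartAt_source_mem_nhds z)
  have heq : η.inChart x₀ =ᶠ[nhds y] fun y' =>
      (η.inChart z (ψ y')).compContinuousLinearMap (fderiv ℝ ψ y') := by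
    filter_upwards [hcont, (isOpen_extChartAt_target x₀).mem_nhds hy] with y' h1 h2
    ext u
    simp only [ContinuousAlternatingMap.compContinuousLinearMap_apply, Function.comp_def, hfd h2 h1]
    exact (η.inChart_extChartAt h1 _).symm
  have hψc : ContDiffAt ℝ ∞ ψ y := by
    rw [← contMDiffAt_iff_contDiffAt]
    refine ContMDiffAt.comp y (contMDiffAt_extChartAt (I := 𝓘(ℝ, E)) (n := ∞))
      ((contMDiffOn_extChartAt_symm x₀).contMDiffAt ((isOpen_extChartAt_target x₀).mem_nhds hy))
  rw [heq.extDeriv_eq, extDeriv_pullback (f := ψ) (x := y) (hη.differentiableAt z) hψc (by simpa using! WithTop.coe_le_coe.2 (le_top : (2 : ℕ∞) ≤ ⊤))]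
  ext u
  simp only [ContinuousAlternatingMap.compContinuousLinearMap_apply, Function.comp_def,
    hfd hy hcont.self_of_nhds]
  rfl

theorem DForm.IsSmooth.d {η : DForm E M k} (hη : η.IsSmooth) : η.d.IsSmooth := by
  intro x₀
  refine ContDiffOn.congr ?_ fun y hy => DForm.inChart_d hη hy
  exact fun y hy => (contDiffAt_extDeriv (hη.contDiffAt hy)).contDiffWithinAt

theorem DForm.d_d {η : DForm E M k} (hη : η.IsSmooth) : η.d.d = 0 := by
  funext x
  have heq : η.d.inChart x =ᶠ[nhds (extChartAt 𝓘(ℝ, E) x x)] extDeriv (η.inChart x) := by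
    filter_upwards [extChartAt_target_mem_nhds (I := 𝓘(ℝ, E)) x] with y hy
    exact DForm.inChart_d hη hy
  rw [DForm.d, heq.extDeriv_eq,
    extDeriv_extDeriv_apply (hη.contDiffAt (mem_extChartAt_target x))
      (by simpa using! WithTop.coe_le_coe.2 (le_top : (2 : ℕ∞) ≤ ⊤))]
  rfl

end Cartan

/-! ### Smoothness criteria, and the forms built from g and J. -/

section Smoothness

variable {E : Type*} [NormedAddCommGroup E] [NormedSpace ℝ E] [FiniteDimensional ℝ E]

/-- A map into continuous alternating maps on a finite-dimensional space is smooth if its values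
on constant tuples are. -/
theorem contDiffOn_of_forall_apply {D : Type*} [NormedAddCommGroup D] [NormedSpace ℝ D]
    {k : ℕ} {f : D → E [⋀^Fin k]→L[ℝ] ℂ} {s : Set D} {n : WithTop ℕ∞}
    (h : ∀ v : Fin k → E, ContDiffOn ℝ n (fun y => f y v) s) : ContDiffOn ℝ n f s := by
  let b := Module.finBasis ℝ E
  let L : (E [⋀^Fin k]→L[ℝ] ℂ) →ₗ[ℝ] ((Fin k → Fin (Module.finrank ℝ E)) → ℂ) :=
    { toFun := fun w t => w fun i => b (t i)
      map_add' := fun _ _ => rfl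
      map_smul' := fun _ _ => rfl }
  -- An alternating map is determined by its values on basis tuples, so `L` has a linear left
  -- inverse, continuous by finite dimension; `f` is recovered smoothly from finitely many scalar
  -- functions.
  have hker : LinearMap.ker L = ⊥ := by
    refine LinearMap.ker_eq_bot'.2 fun w hw => ?_
    refine ContinuousAlternatingMap.toAlternatingMap_injective ?_
    exact Module.Basis.ext_alternating b fun t _ => congrFun hw t
  obtain ⟨R, hR⟩ := L.exists_leftInverse_of_injective hker
  have hf : f = fun y => LinearMap.toContinuousLinearMap R (L (f y)) :=
    funext fun y => (LinearMap.congr_fun hR (f y)).symm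
  rw [hf]
  exact ContDiffOn.continuousLinearMap_comp (LinearMap.toContinuousLinearMap R)
    (contDiffOn_pi.2 fun t => h _)

variable {M : Type*} [TopologicalSpace M] [ChartedSpace E M] [IsManifold 𝓘(ℝ, E) ∞ M]

/-- The vector field on the domain of the chart around `x₀` whose expression in the chart is the
constant `a`. -/
def chartField (x₀ : M) (a : E) : VField E M := fun z =>
  (trivializationAt E (TangentSpace 𝓘(ℝ, E) : M → Type _) x₀).symm z a

theorem trivializationAt_chartField {x₀ z : M} (hz : z ∈ (extChartAt 𝓘(ℝ, E) x₀).source) (a : E) :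
    (trivializationAt E (TangentSpace 𝓘(ℝ, E) : M → Type _) x₀ ⟨z, chartField x₀ a z⟩).2 = a := by
  rw [← trivializationAt_baseSet] at hz
  rw [chartField, Bundle.Trivialization.apply_mk_symm _ hz]

theorem contMDiffOn_chartField (x₀ : M) (a : E) :
    ContMDiffOn 𝓘(ℝ, E) 𝓘(ℝ, E).tangent ∞
      (fun x => (⟨x, chartField x₀ a x⟩ : TangentBundle 𝓘(ℝ, E) M))
      (extChartAt 𝓘(ℝ, E) x₀).source := by
  rw [← trivializationAt_baseSet]
  refine ((trivializationAt E (TangentSpace 𝓘(ℝ, E) : M → Type _)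
    x₀).contMDiffOn_section_baseSet_iff (IB := 𝓘(ℝ, E)) (n := ∞) (s := chartField x₀ a)).2 ?_
  refine (contMDiffOn_const (c := a)).congr fun z hz => ?_
  rw [trivializationAt_baseSet] at hz
  exact trivializationAt_chartField hz a

theorem chartField_inChart (x₀ : M) (a : E) {y : E} (hy : y ∈ (extChartAt 𝓘(ℝ, E) x₀).target) :
    (chartField x₀ a).inChart x₀ y = a := by
  have hz := (extChartAt 𝓘(ℝ, E) x₀).map_target hy
  exact (trivializationAt_snd hz _).symm.trans (trivializationAt_chartField hz a)

/-- A form is smooth if its values on the constant fields in charts are. -/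
theorem DForm.isSmooth_of_chartField {k : ℕ} {η : DForm E M k}
    (h : ∀ (x₀ : M) (a : Fin k → E), ContDiffOn ℝ ∞
      (fun y => η ((extChartAt 𝓘(ℝ, E) x₀).symm y)
        (fun i => chartField x₀ (a i) ((extChartAt 𝓘(ℝ, E) x₀).symm y)))
      (extChartAt 𝓘(ℝ, E) x₀).target) : η.IsSmooth := by
  refine fun x₀ => contDiffOn_of_forall_apply fun a => (h x₀ a).congr fun y hy => ?_
  rw [← η.inChart_apply_inChart (fun i => chartField x₀ (a i)) hy]
  simp only [chartField_inChart _ _ hy]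

theorem Metric.contMDiffOn_pair (g : Metric E M) {X Y : VField E M} {s : Set M}
    (hX : ContMDiffOn 𝓘(ℝ, E) 𝓘(ℝ, E).tangent ∞
      (fun x => (⟨x, X x⟩ : TangentBundle 𝓘(ℝ, E) M)) s)
    (hY : ContMDiffOn 𝓘(ℝ, E) 𝓘(ℝ, E).tangent ∞
      (fun x => (⟨x, Y x⟩ : TangentBundle 𝓘(ℝ, E) M)) s) :
    ContMDiffOn 𝓘(ℝ, E) 𝓘(ℝ, ℝ) ∞ (g.pair X Y) s := by
  intro x hx
  have : ContMDiffWithinAt 𝓘(ℝ, E) (𝓘(ℝ, E).prod 𝓘(ℝ, ℝ)) ∞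
      (fun m ↦ Bundle.TotalSpace.mk' ℝ (E := Bundle.Trivial M ℝ) m (g.val m (X m) (Y m))) s x :=
    ContMDiffWithinAt.clm_bundle_apply₂ (F₁ := E) (F₂ := E)
      (g.smooth x).contMDiffWithinAt (hX x hx) (hY x hx)
  rw [Bundle.contMDiffWithinAt_totalSpace] at this
  exact this.2

theorem Metric.mdifferentiableAt_pair (g : Metric E M) {X Y : VField E M} {x : M}
    (hX : X.DiffAt x) (hY : Y.DiffAt x) :
    MDifferentiableAt 𝓘(ℝ, E) 𝓘(ℝ, ℝ) (g.pair X Y) x := by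
  have : MDifferentiableAt 𝓘(ℝ, E) (𝓘(ℝ, E).prod 𝓘(ℝ, ℝ))
      (fun m ↦ Bundle.TotalSpace.mk' ℝ (E := Bundle.Trivial M ℝ) m (g.val m (X m) (Y m))) x :=
    MDifferentiableAt.clm_bundle_apply₂ (F₁ := E) (F₂ := E)
      ((g.smooth x).mdifferentiableAt (by simp)) hX hY
  rw [mdifferentiableAt_totalSpace] at this
  exact this.2

theorem AlmostComplex.contMDiffOn_apply (J : AlmostComplex E M) {X : VField E M} {s : Set M}
    (hX : ContMDiffOn 𝓘(ℝ, E) 𝓘(ℝ, E).tangent ∞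
      (fun x => (⟨x, X x⟩ : TangentBundle 𝓘(ℝ, E) M)) s) :
    ContMDiffOn 𝓘(ℝ, E) 𝓘(ℝ, E).tangent ∞
      (fun x => (⟨x, J.apply X x⟩ : TangentBundle 𝓘(ℝ, E) M)) s :=
  fun x hx => ContMDiffWithinAt.clm_bundle_apply (F₁ := E) (F₂ := E)
    (J.smooth x).contMDiffWithinAt (hX x hx)

theorem VField.IsSmooth.apply {X : VField E M} (hX : X.IsSmooth) (J : AlmostComplex E M) :
    (J.apply X).IsSmooth :=
  contMDiffOn_univ.1 (J.contMDiffOn_apply (contMDiffOn_univ.2 hX))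

theorem VField.DiffAt.apply {X : VField E M} {x : M} (hX : X.DiffAt x) (J : AlmostComplex E M) :
    (J.apply X).DiffAt x :=
  MDifferentiableAt.clm_bundle_apply (F₁ := E) (F₂ := E)
    ((J.smooth x).mdifferentiableAt (by simp)) hX

/-- The complex-valued one-form `g(X, ·)`. -/
def Metric.flat (g : Metric E M) (X : VField E M) : DForm E M 1 := fun x =>
  ContinuousAlternatingMap.ofSubsingleton ℝ (TangentSpace 𝓘(ℝ, E) x) ℂ (0 : Fin 1)
    (Complex.ofRealCLM ∘L g.val x (X x))

theorem Metric.isSmooth_flat (g : Metric E M) {X : VField E M} (hX : X.IsSmooth) :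
    (g.flat X).IsSmooth := by
  refine DForm.isSmooth_of_chartField fun x₀ a => ?_
  have h := g.contMDiffOn_pair (ContMDiff.contMDiffOn hX) (contMDiffOn_chartField x₀ (a 0))
  have h2 := h.comp (contMDiffOn_extChartAt_symm x₀) fun y hy =>
    (extChartAt 𝓘(ℝ, E) x₀).map_target hy
  exact h2.contDiffOn.continuousLinearMap_comp Complex.ofRealCLM

/-- For a two-form `η`, the two-form `(a, b) ↦ (η(J a, b) + η(a, J b)) / 2`. -/
def AlmostComplex.contract (J : AlmostComplex E M) (η : DForm E M 2) : DForm E M 2 := fun x =>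
  (1 / 2 : ℝ) • ((η x).compContinuousLinearMap (ContinuousLinearMap.id ℝ _ + J.val x) - η x
    - (η x).compContinuousLinearMap (J.val x))

theorem map_swap₂ {V W : Type*} [AddCommGroup V] [Module ℝ V] [TopologicalSpace V]
    [AddCommGroup W] [Module ℝ W] [TopologicalSpace W] (f : V [⋀^Fin 2]→L[ℝ] W) (a b : V) :
    f ![b, a] = -f ![a, b] := by
  have h := f.toAlternatingMap.map_swap ![a, b] (i := 0) (j := 1) (by decide)
  have h2 : ![a, b] ∘ Equiv.swap (0 : Fin 2) 1 = ![b, a] := by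
    funext i; fin_cases i <;> simp
  rw [h2] at h
  exact h

theorem map_add_left₂ {V W : Type*} [AddCommGroup V] [Module ℝ V] [TopologicalSpace V]
    [AddCommGroup W] [Module ℝ W] [TopologicalSpace W] (f : V [⋀^Fin 2]→L[ℝ] W) (a a' b : V) :
    f ![a + a', b] = f ![a, b] + f ![a', b] :=
  f.toAlternatingMap.map_vecCons_add ![b] a a'

theorem map_add_right₂ {V W : Type*} [AddCommGroup V] [Module ℝ V] [TopologicalSpace V]
    [AddCommGroup W] [Module ℝ W] [TopologicalSpace W] (f : V [⋀^Fin 2]→L[ℝ] W) (a b b' : V) :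
    f ![a, b + b'] = f ![a, b] + f ![a, b'] := by
  rw [map_swap₂, map_add_left₂, map_swap₂ f a b, map_swap₂ f a b']
  abel

theorem map_smul_left₂ {V W : Type*} [AddCommGroup V] [Module ℝ V] [TopologicalSpace V]
    [AddCommGroup W] [Module ℝ W] [TopologicalSpace W] (f : V [⋀^Fin 2]→L[ℝ] W) (c : ℝ) (a b : V) :
    f ![c • a, b] = c • f ![a, b] :=
  f.toAlternatingMap.map_vecCons_smul ![b] c a

theorem map_smul_right₂ {V W : Type*} [AddCommGroup V] [Module ℝ V] [TopologicalSpace V]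
    [AddCommGroup W] [Module ℝ W] [TopologicalSpace W] (f : V [⋀^Fin 2]→L[ℝ] W) (c : ℝ) (a b : V) :
    f ![a, c • b] = c • f ![a, b] := by
  rw [map_swap₂, map_smul_left₂, map_swap₂ f a b, smul_neg, neg_neg]

theorem map_neg_left₂ {V W : Type*} [AddCommGroup V] [Module ℝ V] [TopologicalSpace V]
    [AddCommGroup W] [Module ℝ W] [TopologicalSpace W] (f : V [⋀^Fin 2]→L[ℝ] W) (a b : V) :
    f ![-a, b] = -f ![a, b] := by
  simpa using map_smul_left₂ f (-1) a b

/-- Polarization: expanding f(a + La, b + Lb) and removing f(a, b) and f(La, Lb) leaves the mixed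
terms. Writing the contraction through pullbacks makes it alternating and continuous with no further
proof. -/
theorem contract_alternating_apply {V W : Type*} [AddCommGroup V] [Module ℝ V]
    [TopologicalSpace V] [IsTopologicalAddGroup V] [AddCommGroup W] [Module ℝ W]
    [TopologicalSpace W] [IsTopologicalAddGroup W] [ContinuousConstSMul ℝ W]
    (f : V [⋀^Fin 2]→L[ℝ] W) (L : V →L[ℝ] V) (a b : V) :
    ((1 / 2 : ℝ) • (f.compContinuousLinearMap (ContinuousLinearMap.id ℝ V + L) - f
      - f.compContinuousLinearMap L)) ![a, b] = (1 / 2 : ℝ) • (f ![L a, b] + f ![a, L b]) := by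
  have h1 : ∀ L : V →L[ℝ] V, f.compContinuousLinearMap L ![a, b] = f ![L a, L b] := fun L =>
    congrArg f (by funext i; fin_cases i <;> rfl)
  rw [ContinuousAlternatingMap.smul_apply, ContinuousAlternatingMap.sub_apply,
    ContinuousAlternatingMap.sub_apply, h1, h1, add_apply,
    add_apply, map_add_left₂, map_add_right₂, map_add_right₂]
  simp only [ContinuousLinearMap.id_apply]
  congr 1
  abel

theorem AlmostComplex.contract_apply (J : AlmostComplex E M) (η : DForm E M 2) (x : M)
    (a b : TangentSpace 𝓘(ℝ, E) x) :
    J.contract η x ![a, b] = (1 / 2 : ℝ) • (η x ![J.val x a, b] + η x ![a, J.val x b]) :=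
  contract_alternating_apply (η x) (J.val x) a b

-- Induction on the degree: currying the first slot is a linear isometry, and feeding it `u 0`
-- leaves a smooth family of degree `k`.
set_option synthInstance.maxHeartbeats 200000 in
theorem contDiffOn_alternating_apply {D F G : Type*} [NormedAddCommGroup D] [NormedSpace ℝ D]
    [NormedAddCommGroup F] [NormedSpace ℝ F] [NormedAddCommGroup G] [NormedSpace ℝ G]
    {k : ℕ} {f : D → F [⋀^Fin k]→L[ℝ] G} {u : Fin k → D → F} {s : Set D} {n : WithTop ℕ∞}
    (hf : ContDiffOn ℝ n f s) (hu : ∀ i, ContDiffOn ℝ n (u i) s) :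
    ContDiffOn ℝ n (fun y => f y (fun i => u i y)) s := by
  induction k with
  | zero =>
    refine (hf.continuousLinearMap_comp
      (ContinuousAlternatingMap.apply ℝ F G (0 : Fin 0 → F))).congr fun y _ => ?_
    exact congrArg (f y) (Subsingleton.elim _ _)
  | succ k ih =>
    have h0 : ContDiff ℝ n
        (ContinuousAlternatingMap.curryLeftLI (𝕜 := ℝ) (E := F) (F := G) (n := k)) :=
      LinearIsometry.contDiff (𝕜 := ℝ) (E := F [⋀^Fin (k + 1)]→L[ℝ] G)
        (F := F →L[ℝ] F [⋀^Fin k]→L[ℝ] G) ContinuousAlternatingMap.curryLeftLI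
    have h1 : ContDiffOn ℝ n (fun y => (f y).curryLeft) s := h0.comp_contDiffOn hf
    refine (ih (h1.clm_apply (hu 0)) fun i => hu i.succ).congr fun y _ => congrArg (f y) ?_
    funext i
    refine Fin.cases ?_ (fun j => ?_) i <;> rfl

theorem DForm.IsSmooth.contDiffOn_apply {k : ℕ} {η : DForm E M k} (hη : η.IsSmooth) {x₀ : M}
    {X : Fin k → VField E M}
    (hX : ∀ i, ContMDiffOn 𝓘(ℝ, E) 𝓘(ℝ, E).tangent ∞
      (fun x => (⟨x, X i x⟩ : TangentBundle 𝓘(ℝ, E) M)) (extChartAt 𝓘(ℝ, E) x₀).source) :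
    ContDiffOn ℝ ∞ (fun y => η ((extChartAt 𝓘(ℝ, E) x₀).symm y)
      (fun i => X i ((extChartAt 𝓘(ℝ, E) x₀).symm y))) (extChartAt 𝓘(ℝ, E) x₀).target :=
  (contDiffOn_alternating_apply (hη x₀) fun i => VField.contDiffOn_inChart (hX i)).congr
    fun _ hy => (η.inChart_apply_inChart X hy).symm

theorem AlmostComplex.isSmooth_contract (J : AlmostComplex E M) {η : DForm E M 2}
    (hη : η.IsSmooth) : (J.contract η).IsSmooth := by
  refine DForm.isSmooth_of_chartField fun x₀ a => ?_
  have hC := fun i => contMDiffOn_chartField (M := M) x₀ (a i)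
  have h1 := hη.contDiffOn_apply (x₀ := x₀)
    (X := ![J.apply (chartField x₀ (a 0)), chartField x₀ (a 1)])
    (by intro i; fin_cases i; exacts [J.contMDiffOn_apply (hC 0), hC 1])
  have h2 := hη.contDiffOn_apply (x₀ := x₀)
    (X := ![chartField x₀ (a 0), J.apply (chartField x₀ (a 1))])
    (by intro i; fin_cases i; exacts [hC 0, J.contMDiffOn_apply (hC 1)])
  refine ((h1.add h2).const_smul (1 / 2 : ℝ)).congr fun y _ => ?_
  set z := (extChartAt 𝓘(ℝ, E) x₀).symm y
  refine Eq.trans (congrArg (J.contract η z) ?_) ((J.contract_apply η z (chartField x₀ (a 0) z)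
    (chartField x₀ (a 1) z)).trans ?_)
  · funext i; fin_cases i <;> rfl
  · refine congrArg₂ (fun p q => (1 / 2 : ℝ) • (p + q)) (congrArg (η z) ?_) (congrArg (η z) ?_) <;>
    · funext i; fin_cases i <;> rfl

end Smoothness

/-! ### Extending a vector to a field parallel at a point. -/

section Parallel

variable {E : Type*} [NormedAddCommGroup E] [NormedSpace ℝ E] [FiniteDimensional ℝ E]
  {M : Type*} [TopologicalSpace M] [ChartedSpace E M] [IsManifold 𝓘(ℝ, E) ∞ M]

/-- Every covector is the differential of a function vanishing at the given point. -/
theorem exists_mvfderiv_eq {x : M} (l : TangentSpace 𝓘(ℝ, E) x →L[ℝ] ℝ) :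
    ∃ f : M → ℝ, MDifferentiableAt 𝓘(ℝ, E) 𝓘(ℝ, ℝ) f x ∧ f x = 0 ∧
      mvfderiv 𝓘(ℝ, E) f x = l := by
  have : IsManifold 𝓘(ℝ, E) 1 M := .of_le (n := ∞) (by simp)
  obtain ⟨e, he⟩ := isInvertible_mfderiv_extChartAt (I := 𝓘(ℝ, E))
    (mem_extChartAt_source (I := 𝓘(ℝ, E)) x)
  let L : E →L[ℝ] ℝ :=
    l ∘L (e.symm : TangentSpace 𝓘(ℝ, E) (extChartAt 𝓘(ℝ, E) x x) →L[ℝ] TangentSpace 𝓘(ℝ, E) x)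
  let h : E → ℝ := fun y => L (y - extChartAt 𝓘(ℝ, E) x x)
  have hd : HasFDerivAt h L (extChartAt 𝓘(ℝ, E) x x) :=
    L.hasFDerivAt.comp _ ((hasFDerivAt_id _).sub_const _)
  have hφ := mdifferentiableAt_extChartAt (I := 𝓘(ℝ, E)) (mem_chart_source E x)
  have hm := mdifferentiableAt_iff_differentiableAt.2 hd.differentiableAt
  refine ⟨h ∘ extChartAt 𝓘(ℝ, E) x, hm.comp x hφ, by simp [h], ?_⟩
  ext u
  have h1 := mfderiv_comp_apply x hm hφ u
  rw [mfderiv_eq_fderiv, hd.fderiv, ← he] at h1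
  exact h1.trans (congrArg l (e.symm_apply_apply u))

/-- In the Leibniz rule the terms f_i D c_i drop out because each f_i vanishes at `x`; only the
differentials of the f_i survive. -/
theorem CovariantDerivative.sum_smul
    (D : CovariantDerivative 𝓘(ℝ, E) E (TangentSpace 𝓘(ℝ, E) : M → Type _)) {ι : Type*}
    (s : Finset ι) {f : ι → M → ℝ} {c : ι → VField E M} {x : M}
    (hf : ∀ i, MDifferentiableAt 𝓘(ℝ, E) 𝓘(ℝ, ℝ) (f i) x) (hf0 : ∀ i, f i x = 0)
    (hc : ∀ i, (c i).DiffAt x) :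
    VField.DiffAt (fun z => ∑ i ∈ s, f i z • c i z) x ∧
      ∀ w, D (fun z => ∑ i ∈ s, f i z • c i z) x w
        = ∑ i ∈ s, mvfderiv 𝓘(ℝ, E) (f i) x w • c i x := by
  classical
  induction s using Finset.induction_on with
  | empty =>
    refine ⟨Bundle.mdifferentiableAt_zeroSection .., fun w => ?_⟩
    have h := congrFun (CovariantDerivative.zero D) x
    exact congr($h w)
  | insert a s ha ih =>
    have hs : (fun z => ∑ i ∈ insert a s, f i z • c i z)
        = (f a • c a) + fun z => ∑ i ∈ s, f i z • c i z :=
      funext fun z => Finset.sum_insert ha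
    have h1 : VField.DiffAt (f a • c a) x := (hf a).smul_section (hc a)
    rw [hs]
    refine ⟨mdifferentiableAt_add_section h1 ih.1, fun w => ?_⟩
    rw [D.isCovariantDerivativeOnUniv.add h1 ih.1, D.isCovariantDerivativeOnUniv.leibniz (hc a)
      (hf a), hf0 a, Finset.sum_insert ha, ← ih.2 w]
    simp

/-- Every tangent vector extends to a vector field that is parallel at the given point. -/
theorem exists_parallel_extension
    (D : CovariantDerivative 𝓘(ℝ, E) E (TangentSpace 𝓘(ℝ, E) : M → Type _)) {x : M}
    (w : TangentSpace 𝓘(ℝ, E) x) :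
    ∃ X : VField E M, X.DiffAt x ∧ X x = w ∧ D X x = 0 := by
  have : FiniteDimensional ℝ (TangentSpace 𝓘(ℝ, E) x) := inferInstanceAs (FiniteDimensional ℝ E)
  have : T2Space (TangentSpace 𝓘(ℝ, E) x) := inferInstanceAs (T2Space E)
  let b := Module.finBasis ℝ (TangentSpace 𝓘(ℝ, E) x)
  let c : VField E M := FiberBundle.extend E w
  have hc : c.DiffAt x := FiberBundle.mdifferentiableAt_extend ..
  have hb : ∀ i, VField.DiffAt (FiberBundle.extend E (b i) : VField E M) x := fun i =>
    FiberBundle.mdifferentiableAt_extend ..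
  -- Coefficients vanishing at `x` leave the value of `c` there unchanged; their differentials are
  -- minus the components of `D c x` in the basis `b`, so that the correction cancels it.
  have hl := fun i => exists_mvfderiv_eq
    ((-LinearMap.toContinuousLinearMap (b.coord i)) ∘L (D c x))
  choose f hf hf0 hfd using hl
  obtain ⟨h1, h2⟩ := CovariantDerivative.sum_smul D Finset.univ hf hf0 hb
  refine ⟨c + fun z => ∑ i, f i z • FiberBundle.extend E (b i) z,
    mdifferentiableAt_add_section hc h1, ?_, ?_⟩
  · simp [hf0, c]
  · ext u
    rw [D.isCovariantDerivativeOnUniv.add hc h1]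
    have h3 := b.sum_repr (D c x u)
    have h4 : ∑ i, mvfderiv 𝓘(ℝ, E) (f i) x u • (FiberBundle.extend E (b i) : VField E M) x
        = -(D c x u) := by
      rw [← h3, ← Finset.sum_neg_distrib]
      refine Finset.sum_congr rfl fun i _ => ?_
      rw [hfd, FiberBundle.extend_apply_self]
      simp
    have h5 := (h2 u).trans h4
    exact (congrArg (D c x u + ·) h5).trans (add_neg_cancel _)

end Parallel

/-! ### Exterior derivatives through the Levi-Civita connection, and Killing fields. -/

section Killing

variable {E : Type*} [NormedAddCommGroup E] [NormedSpace ℝ E] [FiniteDimensional ℝ E]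
  {M : Type*} [TopologicalSpace M] [ChartedSpace E M] [IsManifold 𝓘(ℝ, E) ∞ M]
  {g : Metric E M} {J : AlmostComplex E M}
  {D : CovariantDerivative 𝓘(ℝ, E) E (TangentSpace 𝓘(ℝ, E) : M → Type _)}

theorem IsLeviCivita.mlieBracket_eq_zero (hD : IsLeviCivita g D) {X Y : VField E M} {x : M}
    (hX : X.DiffAt x) (hY : Y.DiffAt x) (hX0 : D X x = 0) (hY0 : D Y x = 0) :
    VectorField.mlieBracket 𝓘(ℝ, E) X Y x = 0 := by
  rw [← hD.1 X Y x hX hY, hX0, hY0]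
  simp

theorem VField.IsSmooth.diffAt {X : VField E M} (hX : X.IsSmooth) (x : M) : X.DiffAt x :=
  (hX x).mdifferentiableAt (by simp)

theorem mvfderiv_ofReal {f : M → ℝ} {x : M} (hf : MDifferentiableAt 𝓘(ℝ, E) 𝓘(ℝ, ℝ) f x)
    (w : TangentSpace 𝓘(ℝ, E) x) :
    mvfderiv 𝓘(ℝ, E) (fun z => (f z : ℂ)) x w = (mvfderiv 𝓘(ℝ, E) f x w : ℂ) := by
  have h1 : MDifferentiableAt 𝓘(ℝ, ℝ) 𝓘(ℝ, ℂ) Complex.ofRealCLM (f x) :=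
    mdifferentiableAt_iff_differentiableAt.2 Complex.ofRealCLM.differentiableAt
  have h := mfderiv_comp_apply x h1 hf w
  rw [mfderiv_eq_fderiv, ContinuousLinearMap.fderiv] at h
  exact h

/-- The exterior derivative of `g(W, ·)`. -/
theorem IsLeviCivita.d_flat (hD : IsLeviCivita g D) {W : VField E M} (hW : W.IsSmooth) (x : M)
    (a b : TangentSpace 𝓘(ℝ, E) x) :
    (g.flat W).d x ![a, b] = ((g.val x (D W x a) b - g.val x (D W x b) a : ℝ) : ℂ) := by
  obtain ⟨X, hX, rfl, hX0⟩ := exists_parallel_extension D a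
  obtain ⟨Y, hY, rfl, hY0⟩ := exists_parallel_extension D b
  have hWx := hW.diffAt x
  have h := DForm.d_apply (g.isSmooth_flat hW) (x := x) (X := ![X, Y])
    (by intro i; fin_cases i; exacts [hX, hY])
    (by
      intro i j hij
      fin_cases i <;> fin_cases j
      exacts [absurd rfl hij, hD.mlieBracket_eq_zero hX hY hX0 hY0,
        hD.mlieBracket_eq_zero hY hX hY0 hX0, absurd rfl hij])
  have h0 : (fun i => (![X, Y] : Fin 2 → VField E M) i x) = ![X x, Y x] := by
    funext i; fin_cases i <;> rfl
  have h1 : mvfderiv 𝓘(ℝ, E) (fun z => ((g.pair W Y z : ℝ) : ℂ)) x (X x)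
      = (g.val x (D W x (X x)) (Y x) : ℝ) := by
    rw [mvfderiv_ofReal (g.mdifferentiableAt_pair hWx hY), hD.2 W Y x hWx hY, hY0]
    simp
  have h2 : mvfderiv 𝓘(ℝ, E) (fun z => ((g.pair W X z : ℝ) : ℂ)) x (Y x)
      = (g.val x (D W x (Y x)) (X x) : ℝ) := by
    rw [mvfderiv_ofReal (g.mdifferentiableAt_pair hWx hX), hD.2 W X x hWx hX, hX0]
    simp
  rw [h0, Fin.sum_univ_two] at h
  refine h.trans ?_
  rw [Complex.ofReal_sub, ← h1, ← h2, sub_eq_add_neg]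
  congr 1
  · exact one_smul ℤ _
  · exact neg_one_smul ℤ _

/-- The covariant derivative of a Killing field is skew-adjoint. -/
theorem IsKilling.skew {v : VField E M} (hv : IsKilling g v) (hD : IsLeviCivita g D) (x : M)
    (a b : TangentSpace 𝓘(ℝ, E) x) :
    g.val x (D v x a) b + g.val x a (D v x b) = 0 := by
  obtain ⟨X, hX, rfl, hX0⟩ := exists_parallel_extension D a
  obtain ⟨Y, hY, rfl, hY0⟩ := exists_parallel_extension D b
  have hvx := hv.1.diffAt x
  have h := hv.2 X Y x hX hY
  rw [← hD.1 v X x hvx hX, ← hD.1 v Y x hvx hY, hD.2 X Y x hX hY, hX0, hY0] at h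
  simpa using h

theorem d_apply_three (hD : IsLeviCivita g D) {η : DForm E M 2} (hη : η.IsSmooth) {x : M}
    {X Y Z : VField E M} (hX : X.DiffAt x) (hY : Y.DiffAt x) (hZ : Z.DiffAt x)
    (hX0 : D X x = 0) (hY0 : D Y x = 0) (hZ0 : D Z x = 0) :
    η.d x ![X x, Y x, Z x] =
      mvfderiv 𝓘(ℝ, E) (fun z => η z ![Y z, Z z]) x (X x)
      - mvfderiv 𝓘(ℝ, E) (fun z => η z ![X z, Z z]) x (Y x)
      + mvfderiv 𝓘(ℝ, E) (fun z => η z ![X z, Y z]) x (Z x) := by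
  have hd : ∀ i, VField.DiffAt ((![X, Y, Z] : Fin 3 → VField E M) i) x := by
    intro i; fin_cases i; exacts [hX, hY, hZ]
  have hd0 : ∀ i, D ((![X, Y, Z] : Fin 3 → VField E M) i) x = 0 := by
    intro i; fin_cases i; exacts [hX0, hY0, hZ0]
  have h := DForm.d_apply hη hd fun i j _ =>
    hD.mlieBracket_eq_zero (hd i) (hd j) (hd0 i) (hd0 j)
  have h0 : (fun i => (![X, Y, Z] : Fin 3 → VField E M) i x) = ![X x, Y x, Z x] := by
    funext i; fin_cases i <;> rfl
  have e0 : ∀ z, (Fin.removeNth (0 : Fin 3) fun j => (![X, Y, Z] : Fin 3 → VField E M) j z)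
      = ![Y z, Z z] := by intro z; funext i; fin_cases i <;> rfl
  have e1 : ∀ z, (Fin.removeNth (1 : Fin 3) fun j => (![X, Y, Z] : Fin 3 → VField E M) j z)
      = ![X z, Z z] := by intro z; funext i; fin_cases i <;> rfl
  have e2 : ∀ z, (Fin.removeNth (2 : Fin 3) fun j => (![X, Y, Z] : Fin 3 → VField E M) j z)
      = ![X z, Y z] := by intro z; funext i; fin_cases i <;> rfl
  rw [h0, Fin.sum_univ_three] at h
  simp only [e0, e1, e2] at h
  refine h.trans ?_
  rw [sub_eq_add_neg]
  congr 1
  · congr 1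
    · exact one_smul ℤ _
    · exact neg_one_smul ℤ _
  · exact (congrArg (· • _) (by norm_num : (-1 : ℤ) ^ 2 = 1)).trans (one_smul ℤ _)

/-- Replace a by Ja in the hypothesis and use J² = -1. It lets J be moved to the first slot
throughout. -/
theorem apply_left_of_anti {τ : DForm E M 2} {x : M}
    (hanti : ∀ a b : TangentSpace 𝓘(ℝ, E) x, τ x ![J.val x a, J.val x b] = -τ x ![a, b])
    (a b : TangentSpace 𝓘(ℝ, E) x) : τ x ![a, J.val x b] = τ x ![J.val x a, b] := by
  have h := hanti (J.val x a) b
  rw [J.sq, map_neg_left₂] at h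
  exact neg_injective h

theorem AlmostComplex.contract_apply_of_anti (J : AlmostComplex E M) {τ : DForm E M 2} {x : M}
    (hanti : ∀ a b : TangentSpace 𝓘(ℝ, E) x, τ x ![J.val x a, J.val x b] = -τ x ![a, b])
    (a b : TangentSpace 𝓘(ℝ, E) x) : J.contract τ x ![a, b] = τ x ![J.val x a, b] := by
  rw [J.contract_apply, apply_left_of_anti hanti, ← two_smul ℝ, smul_smul]
  norm_num

/-- If `τ` is a closed two-form with `τ(J a, J b) = -τ(a, b)`, then `τ(J ·, ·)` is closed. -/
theorem d_contract_eq_zero (hD : IsLeviCivita g D) (hJ : IsParallel D J) {τ : DForm E M 2}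
    (hτ : τ.IsSmooth) (hdτ : τ.d = 0)
    (hanti : ∀ x (a b : TangentSpace 𝓘(ℝ, E) x), τ x ![J.val x a, J.val x b] = -τ x ![a, b]) :
    (J.contract τ).d = 0 := by
  funext x
  ext u
  choose X hX hXu hX0 using fun i => exists_parallel_extension D (u i)
  have hu : u = ![X 0 x, X 1 x, X 2 x] := by
    funext i; fin_cases i <;> exact (hXu _).symm
  have hJX := fun i => (hX i).apply J
  have hJX0 : ∀ i, D (J.apply (X i)) x = 0 := fun i => by
    ext w
    rw [hJ _ _ (hX i), hX0]
    simp
  have hmid := fun z => apply_left_of_anti (hanti z)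
  have hc : ∀ {X Y Z : VField E M}, X.DiffAt x → Y.DiffAt x → Z.DiffAt x →
      D X x = 0 → D Y x = 0 → D Z x = 0 →
      mvfderiv 𝓘(ℝ, E) (fun z => τ z ![Y z, Z z]) x (X x)
      - mvfderiv 𝓘(ℝ, E) (fun z => τ z ![X z, Z z]) x (Y x)
      + mvfderiv 𝓘(ℝ, E) (fun z => τ z ![X z, Y z]) x (Z x) = 0 := by
    intro X Y Z hX hY hZ hX0 hY0 hZ0
    rw [← d_apply_three hD hτ hX hY hZ hX0 hY0 hZ0, hdτ]
    rfl
  -- Evaluate dτ = 0 with J on each single argument and then on all three. In the sum, the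
  -- derivatives along J-directions cancel against those of `c4`, and what remains is twice the
  -- derivative of τ(J·, ·). The fields J X_i are again parallel at `x`.
  have c1 := hc (hJX 0) (hX 1) (hX 2) (hJX0 0) (hX0 1) (hX0 2)
  have c2 := hc (hX 0) (hJX 1) (hX 2) (hX0 0) (hJX0 1) (hX0 2)
  have c3 := hc (hX 0) (hX 1) (hJX 2) (hX0 0) (hX0 1) (hJX0 2)
  have c4 := hc (hJX 0) (hJX 1) (hJX 2) (hJX0 0) (hJX0 1) (hJX0 2)
  simp only [AlmostComplex.apply, hmid, J.sq, map_neg_left₂, mvfderiv_fun_neg, neg_apply]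
    at c1 c2 c3 c4
  rw [hu, d_apply_three hD (J.isSmooth_contract hτ) (hX 0) (hX 1) (hX 2) (hX0 0) (hX0 1) (hX0 2)]
  simp only [J.contract_apply_of_anti (hanti _)]
  change _ = (0 : ℂ)
  linear_combination (1 / 2 : ℂ) * (c1 + c2 + c3 + c4)

end Killing

/-! ### Bidegrees, and vanishing from the ∂∂̄ property. -/

section Bidegree

variable {E : Type*} [NormedAddCommGroup E] [NormedSpace ℝ E]
  {M : Type*} [TopologicalSpace M] [ChartedSpace E M] [IsManifold 𝓘(ℝ, E) ∞ M]
  {J : AlmostComplex E M} {k : ℕ}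

/-- The case z = i of homogeneity. The factor i^(p-q) already separates all the bidegrees compared
below. -/
theorem HasBidegree.apply_J {p q : ℤ} {η : DForm E M k} (h : HasBidegree J p q η) (x : M)
    (v : Fin k → TangentSpace 𝓘(ℝ, E) x) :
    η x (fun j => J.val x (v j)) = Complex.I ^ p * (-Complex.I) ^ q * η x v := by
  have := h.2 x Complex.I Complex.I_ne_zero v
  simpa using this

/-- A form which has, up to sign, two bidegrees that `J` distinguishes is zero. -/
theorem HasBidegree.eq_zero_of_neg {p q p' q' : ℤ} {η : DForm E M k} (h : HasBidegree J p q η)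
    (h' : HasBidegree J p' q' (-η))
    (hne : Complex.I ^ p * (-Complex.I) ^ q ≠ Complex.I ^ p' * (-Complex.I) ^ q') :
    η = 0 := by
  funext x
  ext v
  have h1 := h.apply_J x v
  have h2 : -η x (fun j => J.val x (v j))
      = Complex.I ^ p' * (-Complex.I) ^ q' * -η x v := h'.apply_J x v
  have h3 : (Complex.I ^ p * (-Complex.I) ^ q - Complex.I ^ p' * (-Complex.I) ^ q') * η x v = 0 := by
    linear_combination -h1 - h2
  exact (mul_eq_zero.1 h3).resolve_left (sub_ne_zero.2 hne)

/-- J has nothing to act on in an empty tuple, so the factor must be 1 wherever the function is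
nonzero. -/
theorem HasBidegree.eq_zero_of_degree_zero {p q : ℤ} {η : DForm E M 0} (h : HasBidegree J p q η)
    (hne : Complex.I ^ p * (-Complex.I) ^ q ≠ 1) : η = 0 := by
  funext x
  ext v
  have h1 := h.apply_J x v
  rw [Subsingleton.elim (fun j => J.val x (v j)) v] at h1
  have h3 : (Complex.I ^ p * (-Complex.I) ^ q - 1) * η x v = 0 := by
    linear_combination -h1
  exact (mul_eq_zero.1 h3).resolve_left (sub_ne_zero.2 hne)

/-- Under the `∂∂̄` property, closed `∂`-exact `(2,0)` forms vanish. -/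
theorem HasDdbarProperty.eq_zero (hddbar : HasDdbarProperty J) {α : DForm E M 2}
    {β : DForm E M 1} (hα : α.d = 0) (h : IsDel J 1 0 β α) : α = 0 := by
  have hI : Complex.I ≠ 1 := fun h => by simpa using congrArg Complex.re h
  have hI2 : (-1 : ℂ) ≠ 1 := by norm_num
  have hI3 : Complex.I ≠ -Complex.I := fun h => by
    have := congrArg Complex.im h
    norm_num at this
  -- Here `lam` is a function of bidegree (1,-1), on which i acts by -1 and also trivially; hence it
  -- is zero.
  obtain ⟨lam, μ, ⟨hlam, hμ, hlamμ⟩, -, hμα, hdμ⟩ :=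
    hddbar 0 2 0 α h.2.1 hα (Or.inl ⟨β, by simpa using h⟩)
  norm_num at hlam hμ hlamμ hμα hdμ
  have hlam0 : lam = 0 := hlam.eq_zero_of_degree_zero (by
    simp [zpow_neg, hI2])
  subst hlam0
  -- With `lam = 0`, μ has bidegree (1,0) and -μ has bidegree (2,-1): factors i and -i. Once μ = 0,
  -- likewise α has bidegree (2,0) and -α has (1,1): factors -1 and 1.
  rw [DForm.d_zero, zero_sub] at hlamμ
  have hμ0 : μ = 0 := hμ.eq_zero_of_neg hlamμ (by
    have : Complex.I ^ (2 : ℤ) = -1 := Complex.I_sq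
    simp [zpow_neg, this, hI3])
  subst hμ0
  rw [DForm.d_zero, zero_sub] at hdμ
  refine hμα.eq_zero_of_neg hdμ ?_
  have : Complex.I ^ (2 : ℤ) = -1 := Complex.I_sq
  simp [this, hI2]

theorem hasBidegree_one_zero {β : DForm E M 1} (hβ : β.IsSmooth)
    (h : ∀ x (a : TangentSpace 𝓘(ℝ, E) x), β x ![J.val x a] = Complex.I * β x ![a]) :
    HasBidegree J 1 0 β := by
  refine ⟨hβ, fun x z _ v => ?_⟩
  have hv : v = ![v 0] := by funext i; fin_cases i; rfl
  have hw : (fun j => z.re • v j + z.im • J.val x (v j))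
      = ![z.re • v 0 + z.im • J.val x (v 0)] := by funext i; fin_cases i; rfl
  have hadd : ∀ a b : TangentSpace 𝓘(ℝ, E) x, β x ![a + b] = β x ![a] + β x ![b] := fun a b =>
    (β x).toAlternatingMap.map_vecCons_add ![] a b
  have hsmul : ∀ (c : ℝ) (a : TangentSpace 𝓘(ℝ, E) x), β x ![c • a] = c • β x ![a] := fun c a =>
    (β x).toAlternatingMap.map_vecCons_smul ![] c a
  rw [hw, hadd, hsmul, hsmul, h, ← hv]
  simp only [Complex.real_smul, zpow_one, zpow_zero, mul_one]
  linear_combination β x v * Complex.re_add_im z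

theorem hasBidegree_two_zero {α : DForm E M 2} (hα : α.IsSmooth)
    (h : ∀ x (a b : TangentSpace 𝓘(ℝ, E) x), α x ![J.val x a, b] = Complex.I * α x ![a, b]) :
    HasBidegree J 2 0 α := by
  refine ⟨hα, fun x z _ v => ?_⟩
  have hv : v = ![v 0, v 1] := by funext i; fin_cases i <;> rfl
  have hw : (fun j => z.re • v j + z.im • J.val x (v j))
      = ![z.re • v 0 + z.im • J.val x (v 0), z.re • v 1 + z.im • J.val x (v 1)] := by
    funext i; fin_cases i <;> rfl
  have h' : α x ![v 0, J.val x (v 1)] = Complex.I * α x ![v 0, v 1] := by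
    rw [map_swap₂, h, map_swap₂ (α x) (v 0) (v 1)]
    ring
  rw [hw, map_add_left₂, map_add_right₂, map_add_right₂, map_smul_left₂, map_smul_left₂,
    map_smul_left₂, map_smul_left₂, map_smul_right₂, map_smul_right₂, map_smul_right₂,
    map_smul_right₂, h, h, h', ← hv]
  simp only [Complex.real_smul, zpow_zero, mul_one]
  rw [show z ^ (2 : ℤ) = z ^ 2 from zpow_ofNat z 2]
  linear_combination α x v * (z + z.re + z.im * Complex.I) * Complex.re_add_im z

/-- Invariance under J makes the two mixed terms cancel, leaving the factor (re z)² + (im z)², which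
is z z̄. -/
theorem hasBidegree_one_one {η : DForm E M 2} (hη : η.IsSmooth)
    (h : ∀ x (a b : TangentSpace 𝓘(ℝ, E) x), η x ![J.val x a, J.val x b] = η x ![a, b]) :
    HasBidegree J 1 1 η := by
  refine ⟨hη, fun x z _ v => ?_⟩
  have hv : v = ![v 0, v 1] := by funext i; fin_cases i <;> rfl
  have hw : (fun j => z.re • v j + z.im • J.val x (v j))
      = ![z.re • v 0 + z.im • J.val x (v 0), z.re • v 1 + z.im • J.val x (v 1)] := by
    funext i; fin_cases i <;> rfl
  have h' : η x ![J.val x (v 0), v 1] = -η x ![v 0, J.val x (v 1)] := by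
    rw [← h x (J.val x (v 0)), J.sq, map_neg_left₂]
  rw [hw, map_add_left₂, map_add_right₂, map_add_right₂, map_smul_left₂, map_smul_left₂,
    map_smul_left₂, map_smul_left₂, map_smul_right₂, map_smul_right₂, map_smul_right₂,
    map_smul_right₂, h, h', ← hv]
  simp only [Complex.real_smul, zpow_one]
  rw [Complex.mul_conj, Complex.normSq_apply]
  push_cast
  ring

end Bidegree

/-! ### The commutator of J with the covariant derivative of a Killing field. -/

section Main

variable {E : Type*} [NormedAddCommGroup E] [NormedSpace ℝ E] [FiniteDimensional ℝ E]
  {M : Type*} [TopologicalSpace M] [ChartedSpace E M] [IsManifold 𝓘(ℝ, E) ∞ M]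
  {g : Metric E M} {J : AlmostComplex E M}
  {D : CovariantDerivative 𝓘(ℝ, E) E (TangentSpace 𝓘(ℝ, E) : M → Type _)}

/-- On a pseudo-Kähler manifold with the `∂∂̄` property, the covariant derivative of a Killing
field commutes with `J`. -/
theorem IsKilling.commute {v : VField E M} (hv : IsKilling g v) (hddbar : HasDdbarProperty J)
    (hD : IsLeviCivita g D) (hJ : IsParallel D J)
    (hiso : ∀ (x : M) (a b : TangentSpace 𝓘(ℝ, E) x),
      g.val x (J.val x a) (J.val x b) = g.val x a b)
    (x : M) (a : TangentSpace 𝓘(ℝ, E) x) : J.val x (D v x a) = D v x (J.val x a) := by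
  have hJg : ∀ x (a b : TangentSpace 𝓘(ℝ, E) x), g.val x (J.val x a) b = -g.val x a (J.val x b) := by
    intro x a b
    rw [← hiso x a, J.sq, map_neg, neg_neg]
  have hq : ∀ x (a b : TangentSpace 𝓘(ℝ, E) x), g.val x (D v x b) a = -g.val x (D v x a) b := by
    intro x a b
    rw [g.symm]
    linarith [hv.skew hD x a b]
  have hβ := g.isSmooth_flat (hv.1.apply J)
  have hκ := g.isSmooth_flat hv.1
  set τ : DForm E M 2 := (g.flat (J.apply v)).d with hτ_def
  have hτs : τ.IsSmooth := hβ.d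
  -- Since J is g-skew, the right-hand side is g((JA - AJ)a, b) with A = `D v x`.
  have hτ : ∀ x (a b : TangentSpace 𝓘(ℝ, E) x), τ x ![a, b]
      = ((-(g.val x (D v x a) (J.val x b) + g.val x (D v x (J.val x a)) b) : ℝ) : ℂ) := by
    intro x a b
    rw [hτ_def, hD.d_flat (hv.1.apply J), hJ _ _ (hv.1.diffAt x), hJ _ _ (hv.1.diffAt x),
      hJg, hJg, hq x (J.val x a) b]
    congr 1
    ring
  have hκd : ∀ x (a b : TangentSpace 𝓘(ℝ, E) x), (g.flat v).d x ![a, b]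
      = ((2 * g.val x (D v x a) b : ℝ) : ℂ) := by
    intro x a b
    rw [hD.d_flat hv.1, hq x a b]
    congr 1
    ring
  have hanti : ∀ x (a b : TangentSpace 𝓘(ℝ, E) x),
      τ x ![J.val x a, J.val x b] = -τ x ![a, b] := by
    intro x a b
    rw [hτ, hτ, J.sq, J.sq]
    simp only [map_neg, neg_apply]
    push_cast
    ring
  have hγ := fun x => J.contract_apply_of_anti (hanti x)
  have hγs := J.isSmooth_contract hτs
  -- The (1,0) part (θ - i θ∘J)/2 of θ = g(Jv, ·), because θ(Ja) = g(Jv, Ja) = g(v, a). Next, `α` is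
  -- the (2,0) part of τ; the contraction is τ(J·, ·) by `hγ`.
  set β : DForm E M 1 := (1 / 2 : ℂ) • (g.flat (J.apply v) - Complex.I • g.flat v) with hβ_def
  set α : DForm E M 2 := (1 / 2 : ℂ) • (τ - Complex.I • J.contract τ) with hα_def
  have hβs : β.IsSmooth := (hβ.sub (hκ.smul _)).smul _
  have hαs : α.IsSmooth := (hτs.sub (hγs.smul _)).smul _
  have hα : ∀ x (a b : TangentSpace 𝓘(ℝ, E) x),
      α x ![a, b] = 1 / 2 * (τ x ![a, b] - Complex.I * τ x ![J.val x a, b]) := by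
    intro x a b
    rw [← hγ]
    rfl
  have hdα : α.d = 0 := by
    rw [hα_def, DForm.d_smul, DForm.d_sub hτs (hγs.smul _), DForm.d_smul, DForm.d_d hβ,
      d_contract_eq_zero hD hJ hτs (DForm.d_d hβ) hanti]
    funext x
    ext u
    change (1 / 2 : ℂ) * (0 - Complex.I * 0) = 0
    ring
  have hdβ : β.d = (1 / 2 : ℂ) • (τ - Complex.I • (g.flat v).d) := by
    rw [hβ_def, DForm.d_smul, DForm.d_sub hβ (hκ.smul _), DForm.d_smul]
  have hdel : IsDel J 1 0 β α := by
    refine ⟨hasBidegree_one_zero hβs fun x a => ?_, hasBidegree_two_zero hαs fun x a b => ?_,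
      hasBidegree_one_one (hβs.d.sub hαs) fun x a b => ?_⟩
    · change (1 / 2 : ℂ) * ((g.val x (J.val x (v x)) (J.val x a) : ℂ)
          - Complex.I * (g.val x (v x) (J.val x a) : ℂ))
        = Complex.I * ((1 / 2 : ℂ) * ((g.val x (J.val x (v x)) a : ℂ)
          - Complex.I * (g.val x (v x) a : ℂ)))
      rw [hiso, hJg]
      push_cast
      linear_combination (1 / 2 : ℂ) * (g.val x (v x) a : ℂ) * Complex.I_sq
    · rw [hα, hα, J.sq, map_neg_left₂]
      linear_combination (1 / 2 : ℂ) * τ x ![J.val x a, b] * Complex.I_sq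
    -- The terms in τ(a, b) cancel. By `hτ` and `hκd` the difference left is a multiple of g(Aa, b)
    -- + g(AJa, Jb), which is visibly J-invariant.
    · have hF : ∀ a b : TangentSpace 𝓘(ℝ, E) x, (β.d - α) x ![a, b]
          = Complex.I / 2 * (τ x ![J.val x a, b] - (g.flat v).d x ![a, b]) := by
        intro a b
        have h1 : β.d x ![a, b] = 1 / 2 * (τ x ![a, b] - Complex.I * (g.flat v).d x ![a, b]) := by
          rw [hdβ]
          rfl
        have h2 : (β.d - α) x ![a, b] = β.d x ![a, b] - α x ![a, b] := rfl
        rw [h2, h1, hα]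
        ring
      rw [hF, hF, hτ, hτ, hκd, hκd, J.sq, J.sq]
      simp only [map_neg, neg_apply]
      push_cast
      ring
  have hα0 : α = 0 := hddbar.eq_zero hdα hdel
  refine sub_eq_zero.1 (g.nondegenerate x _ fun b => ?_)
  have h := hα x a b
  rw [hα0, hτ, hτ] at h
  -- τ is real-valued, so the real part of α(a, b) is τ(a, b)/2.
  have h2 := congrArg Complex.re h
  have h3 : (((0 : DForm E M 2) x ![a, b] : ℂ)).re = 0 := rfl
  rw [h3] at h2
  simp at h2
  rw [map_sub, sub_apply, hJg]
  linarith

end Main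

end PseudoKahler

end

/-- Every Killing vector field on a compact pseudo-Kähler manifold with the `∂∂̄` property is real
holomorphic. -/
theorem theoremA {E : Type*} [NormedAddCommGroup E] [NormedSpace ℝ E] [FiniteDimensional ℝ E]
    {M : Type*} [TopologicalSpace M] [ChartedSpace E M] [IsManifold 𝓘(ℝ, E) ∞ M]
    [T2Space M] [CompactSpace M]
    (g : PseudoKahler.Metric E M) (J : PseudoKahler.AlmostComplex E M)
    (hgJ : PseudoKahler.IsPseudoKahler g J)
    (hddbar : PseudoKahler.HasDdbarProperty J)
    (v : PseudoKahler.VField E M) (hv : PseudoKahler.IsKilling g v) :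
    PseudoKahler.IsRealHolomorphic J v := by
  obtain ⟨hiso, D, hD, hJ⟩ := hgJ
  intro X x hX
  have hvx := hv.1.diffAt x
  -- By torsion-freeness (£_v J)X = D_v(JX) - D_{JX}v - J D_v X + J D_X v. The terms differentiating
  -- X cancel as J is parallel, and `hv.commute` cancels the other two.
  rw [PseudoKahler.lieDerivJ, ← hD.1 v _ x hvx (hX.apply J), ← hD.1 v X x hvx hX,
    hJ X x hX, map_sub, hv.commute hddbar hD hJ hiso]
  exact (sub_sub_sub_cancel_left _ _ _).trans (sub_self _)
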